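/- Consider a $K$-tier network in the plane. The macrocell base stations (MBSs) form a homogeneous Poisson point process $\Phi_{\mathrm M}$ of density $\lambda_{\mathrm M}>0$, and the small-cell base stations (SBSs) of tier $i$ ($i=2,\dots,K$) form a homogeneous Poisson point process $\Phi_i$ of density $\lambda_i>0$; all these processes are independent. A typical user is located at a fixed point $u$. An MBS has $N\ge 1$ antennas and transmit power $P_{\mathrm M}>0$ and serves $S\ge 1$ single-antenna users with equal-time sharing; an SBS of tier $i$ has transmit power $P_i>0$. The average power received by the user from an MBS at distance $r$ is $G_a^{\mathrm D}\frac{P_{\mathrm M}}{S}\beta r^{-\alpha_{\mathrm M}}$, and from an SBS of tier $i$ at distance $r$ it is $P_i\beta r^{-\alpha_i}$, where $\beta,\alpha_{\mathrm M},\alpha_i>0$. Here the power gain is $G_a^{\mathrm D}=\mathbb E\{h\}+(S-1)\,\mathbb E\{h'\}$ with $h\sim\Gamma(N,1)$ (channel power gain of the transfer directed to the user) and $h'\sim\exp(1)$ (channel power gain while the MBS directs energy to its other $S-1$ users). Under association based on the downlink received signal power (DRSP), the user is served by the base station, among those of all tiers, with the largest average received power. Then $G_a^{\mathrm D}=N+S-1$.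 Put $$\hat r_{\mathrm{MS},i}=\Big(G_a^{\mathrm D}\frac{P_{\mathrm M}}{SP_i}\Big)^{-1/\alpha_i},\qquad \hat r_{\mathrm{SM},k}=\Big(\frac{SP_k}{G_a^{\mathrm D}P_{\mathrm M}}\Big)^{-1/\alpha_{\mathrm M}},\qquad \hat r_{\mathrm{SS},k,i}=\Big(\frac{P_k}{P_i}\Big)^{-1/\alpha_i}.$$ The probability that the user is associated with an MBS is $$\Psi_{\mathrm M}^{\mathrm{DRSP}}=2\pi\lambda_{\mathrm M}\int_0^\infty r\exp\Big(-\pi\lambda_{\mathrm M}r^2-\pi\sum_{i=2}^K\lambda_i\hat r_{\mathrm{MS},i}^2\,r^{2\alpha_{\mathrm M}/\alpha_i}\Big)dr,$$ which is positive and finite, and, conditionally on this event, the distance between the user and its serving MBS has the probability density function $$f_{|X_{o,\mathrm M}|}^{\mathrm{DRSP}}(x)=\frac{2\pi\lambda_{\mathrm M}x}{\Psi_{\mathrm M}^{\mathrm{DRSP}}}\exp\Big(-\pi\lambda_{\mathrm M}x^2-\pi\sum_{i=2}^K\lambda_i\hat r_{\mathrm{MS},i}^2\,x^{2\alpha_{\mathrm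 M}/\alpha_i}\Big),\qquad x\ge 0.$$ For each $k\in\{2,\dots,K\}$, the probability that the user is associated with an SBS of tier $k$ is $$\Psi_k^{\mathrm{DRSP}}=2\pi\lambda_k\int_0^\infty r\exp\Big(-\pi\lambda_{\mathrm M}\hat r_{\mathrm{SM},k}^2\,r^{2\alpha_k/\alpha_{\mathrm M}}-\pi\sum_{i=2}^K\lambda_i\hat r_{\mathrm{SS},k,i}^2\,r^{2\alpha_k/\alpha_i}\Big)dr,$$ which is positive and finite, and, conditionally on this event, the distance between the user and its serving SBS has the probability density function $$f_{|X_{o,k}|}^{\mathrm{DRSP}}(y)=\frac{2\pi\lambda_ky}{\Psi_k^{\mathrm{DRSP}}}\exp\Big(-\pi\lambda_{\mathrm M}\hat r_{\mathrm{SM},k}^2\,y^{2\alpha_k/\alpha_{\mathrm M}}-\pi\sum_{i=2}^K\lambda_i\hat r_{\mathrm{SS},k,i}^2\,y^{2\alpha_k/\alpha_i}\Big),\qquad y\ge 0.$$ -/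

import Mathlib

open MeasureTheory ProbabilityTheory Set

noncomputable section

/-- The plane `ℝ²` with its Euclidean metric. -/
abbrev Plane : Type := EuclideanSpace ℝ (Fin 2)

/-- The indices `2, …, K` of the small-cell tiers of a `K`-tier network. -/
abbrev SmallTier (K : ℕ) : Type := Finset.Icc 2 K

/-- The tiers of a `K`-tier network: the macrocell tier and the small-cell tiers `2, …, K`. -/
abbrev Tier (K : ℕ) : Type := Option (SmallTier K)

/-- The tier of the macrocell base stations (MBSs). -/
abbrev Tier.mbs {K : ℕ} : Tier K := none

/-- The `k`-th tier, consisting of small-cell base stations (SBSs). -/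
abbrev Tier.sbs {K : ℕ} (k : SmallTier K) : Tier K := some k

/-! ### Homogeneous Poisson point processes -/

section PointProcess

variable {Ω : Type*} [MeasurableSpace Ω]

/-- The number of points (possibly infinite) of a random set `Φ` in `B`. -/
def pointCount (Φ : Ω → Set Plane) (B : Set Plane) (ω : Ω) : ℕ∞ := (Φ ω ∩ B).encard

/-- `Φ` is a homogeneous Poisson point process on the plane with density `dens` (points per unit
area): a random locally finite set such that the number of points in a Borel set `B` of finite area
is Poisson distributed with mean `dens * area B`, and the numbers of points in finitely many
pairwise disjoint Borel sets are independent. -/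
structure IsHPPP (Φ : Ω → Set Plane) (dens : ℝ) (μ : Measure Ω) : Prop where
  locallyFinite : ∀ ω, ∀ B : Set Plane, Bornology.IsBounded B → (Φ ω ∩ B).Finite
  measurable_count : ∀ B : Set Plane, MeasurableSet B → Measurable (pointCount Φ B)
  law_count : ∀ B : Set Plane, MeasurableSet B → volume B ≠ ⊤ →
    HasLaw (pointCount Φ B)
      ((poissonMeasure (ENNReal.ofReal dens * volume B).toNNReal).map (Nat.cast : ℕ → ℕ∞)) μ
  indep_count : ∀ (n : ℕ) (B : Fin n → Set Plane), (∀ i, MeasurableSet (B i)) →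
    Pairwise (fun i j => Disjoint (B i) (B j)) → iIndepFun (fun i => pointCount Φ (B i)) μ

/-- The σ-algebra on `Ω` generated by the point process `Φ`, that is, by all its counts of points
in Borel sets. -/
abbrev pointSigma (Φ : Ω → Set Plane) : MeasurableSpace Ω :=
  ⨆ B : {B : Set Plane // MeasurableSet B},
    MeasurableSpace.comap (pointCount Φ B.1) inferInstance

end PointProcess

/-! ### The network -/

/-- The numerical parameters of a `K`-tier heterogeneous network. -/
structure HetNet (K : ℕ) where
  /-- number of antennas of each MBS -/
  N : ℕ
  /-- number of single-antenna users served by each MBS -/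
  S : ℕ
  /-- frequency-dependent constant of the path loss -/
  β : ℝ
  /-- transmit power of the base stations of each tier -/
  P : Tier K → ℝ
  /-- path loss exponent of each tier -/
  α : Tier K → ℝ
  /-- density of the base stations of each tier -/
  dens : Tier K → ℝ

namespace HetNet

variable {K : ℕ} (net : HetNet K)

/-- The downlink power gain of a user associated with an MBS. The directed transfer to the user
takes up `1 / S` of the time and has channel power gain `h ∼ Γ(N, 1)` under maximal-ratio
transmission; the remaining `(S - 1) / S` of the time the MBS directs energy to its other users, and
the user receives it with channel power gain `h' ∼ exp(1)`. The average power received from the MBS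
is thus `P (𝔼 h / S + 𝔼 h' (S - 1) / S) L = G (P / S) L` with `G = 𝔼 h + (S - 1) 𝔼 h'`. -/
def downlinkGain : ℝ :=
  (∫ h, h ∂(gammaMeasure (net.N : ℝ) 1)) + ((net.S : ℝ) - 1) * ∫ h, h ∂(expMeasure 1)

/-- The path loss function `L(r) = β r ^ (-α)` of a tier at distance `r`. -/
def pathLoss (t : Tier K) (r : ℝ) : ℝ := net.β * r ^ (-(net.α t))

/-- The average power received from a base station of tier `t` at distance `r`. -/
def receivedPower : Tier K → ℝ → ℝ
  | none, r => net.downlinkGain * (net.P Tier.mbs / net.S) * net.pathLoss Tier.mbs r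
  | some k, r => net.P (Tier.sbs k) * net.pathLoss (Tier.sbs k) r

section Association

variable {Ω : Type*} (Φ : Tier K → Ω → Set Plane) (u : Plane)

/-- DRSP-based association: the base station at `x` in tier `t` serves the user at `u` if its average
received power is the largest among all the base stations of all the tiers. -/
def IsServing (ω : Ω) (t : Tier K) (x : Plane) : Prop :=
  x ∈ Φ t ω ∧ ∀ s : Tier K, ∀ y ∈ Φ s ω,
    net.receivedPower s (dist u y) ≤ net.receivedPower t (dist u x)

/-- The event that the user at `u` is associated with a base station of tier `t`. -/
def assocEvent (t : Tier K) : Set Ω := {ω | ∃ x, net.IsServing Φ u ω t x}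

/-- The distance between the user at `u` and its serving base station, on the event that the latter
belongs to tier `t` (all candidates, if there were several, are then at the same distance). -/
def servingDist (t : Tier K) (ω : Ω) : ℝ := sInf {r | ∃ x, net.IsServing Φ u ω t x ∧ r = dist u x}

end Association

/-! ### The explicit formulas -/

/-- `r̂_MS = (G P_M / (S P_i)) ^ (-1 / α_i)` with `G = N + S - 1`. -/
def rMS (i : SmallTier K) : ℝ :=
  (((net.N : ℝ) + net.S - 1) * (net.P Tier.mbs / (net.S * net.P (Tier.sbs i))))
    ^ (-1 / net.α (Tier.sbs i))

/-- `r̂_SM = (S P_k / (G P_M)) ^ (-1 / α_M)` with `G = N + S - 1`. -/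
def rSM (k : SmallTier K) : ℝ :=
  (net.S * net.P (Tier.sbs k) / (((net.N : ℝ) + net.S - 1) * net.P Tier.mbs))
    ^ (-1 / net.α Tier.mbs)

/-- `r̂_SS = (P_k / P_i) ^ (-1 / α_i)`. -/
def rSS (k i : SmallTier K) : ℝ :=
  (net.P (Tier.sbs k) / net.P (Tier.sbs i)) ^ (-1 / net.α (Tier.sbs i))

/-- `r exp(-π λ_M r² - π ∑_{i=2}^K λ_i r̂_MS² r ^ (2 α_M / α_i))`. -/
def kernelM (r : ℝ) : ℝ :=
  r * Real.exp (-Real.pi * net.dens Tier.mbs * r ^ 2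
    - Real.pi * ∑ i : SmallTier K, net.dens (Tier.sbs i) * net.rMS i ^ 2
        * r ^ (2 * net.α Tier.mbs / net.α (Tier.sbs i)))

/-- `r exp(-π λ_M r̂_SM² r ^ (2 α_k / α_M) - π ∑_{i=2}^K λ_i r̂_SS² r ^ (2 α_k / α_i))`. -/
def kernelS (k : SmallTier K) (r : ℝ) : ℝ :=
  r * Real.exp (-Real.pi * net.dens Tier.mbs * net.rSM k ^ 2
        * r ^ (2 * net.α (Tier.sbs k) / net.α Tier.mbs)
    - Real.pi * ∑ i : SmallTier K, net.dens (Tier.sbs i) * net.rSS k i ^ 2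
        * r ^ (2 * net.α (Tier.sbs k) / net.α (Tier.sbs i)))

/-- `Ψ_M = 2 π λ_M ∫_0^∞ r exp(…) dr`. -/
def psiM : ℝ := 2 * Real.pi * net.dens Tier.mbs * ∫ r in Ioi 0, net.kernelM r

/-- `Ψ_k = 2 π λ_k ∫_0^∞ r exp(…) dr`. -/
def psiS (k : SmallTier K) : ℝ :=
  2 * Real.pi * net.dens (Tier.sbs k) * ∫ r in Ioi 0, net.kernelS k r

/-- The density `(2 π λ_M / Ψ_M) x exp(…)`, for `x ≥ 0`, of the distance to the serving MBS. -/
def pdfM (x : ℝ) : ℝ :=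
  if 0 ≤ x then 2 * Real.pi * net.dens Tier.mbs / net.psiM * net.kernelM x else 0

/-- The density `(2 π λ_k / Ψ_k) y exp(…)`, for `y ≥ 0`, of the distance to the serving SBS of
tier `k`. -/
def pdfS (k : SmallTier K) (y : ℝ) : ℝ :=
  if 0 ≤ y then 2 * Real.pi * net.dens (Tier.sbs k) / net.psiS k * net.kernelS k y else 0

end HetNet

end

/-!
For each tier `s` let `D s = infDist u (Φ s)` be the distance from the user to the nearest base
station of the tier. The void probability of a disc of radius `r` shows that `D s` has the tail
`exp (-π λₛ r²)`, hence the density `2 π λₛ r exp (-π λₛ r²)` on `(0, ∞)`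
(`IsHPPP.measure_le_infDist`, `map_eq_withDensity_of_tail`), and the `D s` are independent since the
processes are.

A base station of tier `t` at distance `r > 0` is received at least as strongly as one of tier `s`
at distance `d > 0` exactly if `d` is at least the exclusion radius
`ρ t s r = (A t / A s) ^ (-1 / α s) * r ^ (α t / α s)`, where `A t * r ^ (-α t)` is the received
power (`HetNet.receivedPower_le_iff`). Almost surely all `D s` are positive, which excludes the
junk value `0 ^ (-α) = 0` of the path loss at distance `0`. The user is then associated with tier `t`
exactly if `ρ t s (D t) ≤ D s` for all `s`, and the serving distance is `D t`
(`HetNet.mem_assocEvent_iff`, `HetNet.servingDist_eq`). Conditioning on `D t = r` gives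

`ℙ(association with t, D t ∈ B) = ∫ r in B ∩ (0, ∞), 2 π λₜ r exp (-π ∑ s, λₛ (ρ t s r)²)`

(`measure_competition`), because `ρ t t r = r` merges the density of `D t` with the other factors.
The integrand is `2 π λₜ` times the kernel of tier `t`, so `B = ℝ` yields the association
probability and division by it the conditional density (`HetNet.assoc_law`).
-/

/-! ### Mean of the Gamma distribution -/

lemma integral_id_gammaMeasure {a r : ℝ} (ha : 0 < a) (hr : 0 < r) :
    ∫ x, x ∂(gammaMeasure a r) = a / r := by
  have hm : Measurable (gammaPDF a r) := (measurable_gammaPDFReal a r).ennreal_ofReal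
  rw [gammaMeasure, integral_withDensity_eq_integral_toReal_smul hm
    (ae_of_all _ fun x => ENNReal.ofReal_lt_top)]
  have h1 : (fun x => (gammaPDF a r x).toReal • x) =
      (Ioi (0 : ℝ)).indicator
        (fun x => r ^ a / Real.Gamma a * (x ^ ((a + 1) - 1) * Real.exp (-(r * x)))) := by
    funext x
    rw [gammaPDF, ENNReal.toReal_ofReal (gammaPDFReal_nonneg ha hr x), smul_eq_mul]
    rcases lt_trichotomy x 0 with hx | rfl | hx
    · simp [gammaPDFReal, not_le.2 hx, not_lt.2 hx.le]
    · simp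
    · rw [indicator_of_mem (mem_Ioi.2 hx), gammaPDFReal, if_pos hx.le,
        show a + 1 - 1 = (a - 1) + 1 by ring, Real.rpow_add_one hx.ne']
      ring
  rw [h1, integral_indicator measurableSet_Ioi, integral_const_mul,
    Real.integral_rpow_mul_exp_neg_mul_Ioi (by positivity) hr, Real.Gamma_add_one ha.ne',
    Real.div_rpow zero_le_one hr.le, Real.one_rpow, Real.rpow_add_one hr.ne']
  have := (Real.Gamma_pos_of_pos ha).ne'
  have := (Real.rpow_pos_of_pos hr a).ne'
  field_simp

/-! ### The distance to the nearest point of a Poisson process -/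

section Nearest

variable {Ω : Type*}

lemma pointCount_eq_zero_iff {Φ : Ω → Set Plane} {B : Set Plane} {ω : Ω} :
    pointCount Φ B ω = 0 ↔ Φ ω ∩ B = ∅ := by
  rw [pointCount, Set.encard_eq_zero]

lemma measurable_pointCount_pointSigma (Φ : Ω → Set Plane) {B : Set Plane} (hB : MeasurableSet B) :
    Measurable[pointSigma Φ] (pointCount Φ B) :=
  (comap_measurable _).mono
    (le_iSup (fun B : {B : Set Plane // MeasurableSet B} =>
      MeasurableSpace.comap (pointCount Φ B.1) inferInstance) ⟨B, hB⟩) le_rfl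

/-- The distance from `u` to the nearest point is determined by the counts of points: it is less
than `a > 0` exactly if the ball of radius `a` is charged or, since `infDist u ∅ = 0`, there is no
point at all. -/
lemma measurable_infDist_pointSigma (Φ : Ω → Set Plane) (u : Plane) :
    Measurable[pointSigma Φ] fun ω => Metric.infDist u (Φ ω) := by
  let _ : MeasurableSpace Ω := pointSigma Φ
  refine measurable_of_Iio fun a => ?_
  have h0 {B : Set Plane} (hB : MeasurableSet B) :
      MeasurableSet[pointSigma Φ] {ω | pointCount Φ B ω = 0} :=
    measurable_pointCount_pointSigma Φ hB (measurableSet_singleton 0)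
  rcases le_or_gt a 0 with ha | ha
  · convert MeasurableSet.empty
    ext ω
    simpa using ha.trans Metric.infDist_nonneg
  · convert (h0 MeasurableSet.univ).union
      (h0 (Metric.isOpen_ball (x := u) (ε := a)).measurableSet).compl
    ext ω
    simp only [mem_preimage, mem_Iio, mem_union, mem_ofPred_eq, mem_compl_iff,
      pointCount_eq_zero_iff, inter_univ]
    rcases (Φ ω).eq_empty_or_nonempty with h | h
    · simp [h, ha]
    · simp only [Metric.infDist_lt_iff h, h.ne_empty, false_or, ← nonempty_iff_ne_empty, ← ne_eq]
      simp [Set.Nonempty, dist_comm]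

namespace IsHPPP

variable [MeasurableSpace Ω] {Φ : Ω → Set Plane} {dens : ℝ} {μ : Measure Ω}

lemma pointSigma_le (hΦ : IsHPPP Φ dens μ) : pointSigma Φ ≤ ‹MeasurableSpace Ω› :=
  iSup_le fun B => (hΦ.measurable_count B.1 B.2).comap_le

lemma measurable_infDist (hΦ : IsHPPP Φ dens μ) (u : Plane) :
    Measurable fun ω => Metric.infDist u (Φ ω) :=
  (measurable_infDist_pointSigma Φ u).mono hΦ.pointSigma_le le_rfl

lemma measure_void (hΦ : IsHPPP Φ dens μ) {B : Set Plane} (hB : MeasurableSet B)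
    (hfin : volume B ≠ ⊤) :
    μ {ω | pointCount Φ B ω = 0} =
      ENNReal.ofReal (Real.exp (-(ENNReal.ofReal dens * volume B).toReal)) := by
  have hpre : (Nat.cast : ℕ → ℕ∞) ⁻¹' {0} = {0} := by ext n; simp
  have h := (hΦ.law_count B hB hfin).measure_eq (p := fun n => n = 0) (measurableSet_singleton 0)
  rw [h, show {x : ℕ∞ | x = 0} = {0} from rfl,
    Measure.map_apply .of_discrete (measurableSet_singleton 0), hpre, poissonMeasure_singleton]
  simp [ENNReal.toReal]

lemma measure_void_ball (hΦ : IsHPPP Φ dens μ) (hd : 0 ≤ dens) (u : Plane) {r : ℝ} (hr : 0 ≤ r) :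
    μ {ω | pointCount Φ (Metric.ball u r) ω = 0} =
      ENNReal.ofReal (Real.exp (-(Real.pi * dens * r ^ 2))) := by
  rw [hΦ.measure_void Metric.isOpen_ball.measurableSet measure_ball_lt_top.ne,
    EuclideanSpace.volume_ball_fin_two]
  congr 3
  simp [ENNReal.toReal_mul, hd, hr, Real.pi_pos.le]
  ring

/-- There is a point almost surely, as the discs of radius `n` are void with probability tending
to `0`. -/
lemma measure_empty (hΦ : IsHPPP Φ dens μ) (hd : 0 < dens) : μ {ω | Φ ω = ∅} = 0 := by
  have hle (n : ℕ) : μ {ω | Φ ω = ∅} ≤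
      ENNReal.ofReal (Real.exp (-(Real.pi * dens * (n : ℝ) ^ 2))) := by
    rw [← hΦ.measure_void_ball hd.le 0 n.cast_nonneg]
    refine measure_mono fun ω (hω : Φ ω = ∅) => ?_
    simp [pointCount_eq_zero_iff, hω]
  have hlim : Filter.Tendsto
      (fun n : ℕ => ENNReal.ofReal (Real.exp (-(Real.pi * dens * (n : ℝ) ^ 2))))
      Filter.atTop (nhds 0) := by
    rw [← ENNReal.ofReal_zero]
    refine (ENNReal.continuous_ofReal.tendsto 0).comp (Real.tendsto_exp_neg_atTop_nhds_zero.comp ?_)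
    exact ((Filter.tendsto_pow_atTop two_ne_zero).comp
      tendsto_natCast_atTop_atTop).const_mul_atTop (by positivity)
  exact le_antisymm (ge_of_tendsto' hlim hle) bot_le

lemma measure_le_infDist [IsProbabilityMeasure μ] (hΦ : IsHPPP Φ dens μ) (hd : 0 < dens)
    (u : Plane) {r : ℝ} (hr : 0 ≤ r) :
    μ {ω | r ≤ Metric.infDist u (Φ ω)} =
      ENNReal.ofReal (Real.exp (-(Real.pi * dens * r ^ 2))) := by
  rcases hr.eq_or_lt with rfl | hr0
  · simp [Metric.infDist_nonneg]
  rw [← hΦ.measure_void_ball hd.le u hr]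
  refine measure_congr ?_
  have hne : ∀ᵐ ω ∂μ, (Φ ω).Nonempty := by
    simpa [ae_iff, not_nonempty_iff_eq_empty] using hΦ.measure_empty hd
  filter_upwards [hne] with ω hω
  refine propext (?_ : r ≤ Metric.infDist u (Φ ω) ↔ pointCount Φ (Metric.ball u r) ω = 0)
  rw [pointCount_eq_zero_iff, Metric.le_infDist hω, ← disjoint_iff_inter_eq_empty,
    Set.disjoint_left]
  simp [dist_comm]

end IsHPPP

end Nearest

/-! ### Competing independent distances -/

section Competition

lemma lintegral_Ioi_rayleigh {l : ℝ} (hl : 0 < l) {a : ℝ} (ha : 0 ≤ a) :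
    ∫⁻ r in Ioi a, ENNReal.ofReal (2 * Real.pi * l * r * Real.exp (-(Real.pi * l * r ^ 2))) =
      ENNReal.ofReal (Real.exp (-(Real.pi * l * a ^ 2))) := by
  have hderiv : ∀ x ∈ Ici a, HasDerivAt (fun r => -Real.exp (-(Real.pi * l * r ^ 2)))
      (2 * Real.pi * l * x * Real.exp (-(Real.pi * l * x ^ 2))) x := fun x _ => by
    have h := ((((hasDerivAt_id x).pow 2).const_mul (Real.pi * l)).neg).exp.neg
    convert! h using 1
    simp
    ring
  have hpos : ∀ x ∈ Ioi a, 0 ≤ 2 * Real.pi * l * x * Real.exp (-(Real.pi * l * x ^ 2)) :=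
    fun x hx => by
      have : 0 ≤ x := ha.trans (le_of_lt hx)
      positivity
  have hlim : Filter.Tendsto (fun r : ℝ => -Real.exp (-(Real.pi * l * r ^ 2)))
      Filter.atTop (nhds 0) := by
    rw [← neg_zero]
    refine (Real.tendsto_exp_neg_atTop_nhds_zero.comp ?_).neg
    exact (Filter.tendsto_pow_atTop two_ne_zero).const_mul_atTop (by positivity)
  rw [← ofReal_integral_eq_lintegral_ofReal (integrableOn_Ioi_deriv_of_nonneg' hderiv hpos hlim)
    ((ae_restrict_iff' measurableSet_Ioi).2 (ae_of_all _ hpos)),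
    integral_Ioi_of_hasDerivAt_of_nonneg' hderiv hpos hlim]
  simp

variable {Ω : Type*} [MeasurableSpace Ω] {μ : Measure Ω} [IsProbabilityMeasure μ]

/-- A nonnegative random variable with tail `exp (-π l r²)` has the density
`2 π l r exp (-π l r²)` on `(0, ∞)`. -/
lemma map_eq_withDensity_of_tail {D : Ω → ℝ} (hD : Measurable D) {l : ℝ} (hl : 0 < l)
    (hnn : ∀ ω, 0 ≤ D ω)
    (htail : ∀ r, 0 ≤ r → μ {ω | r ≤ D ω} = ENNReal.ofReal (Real.exp (-(Real.pi * l * r ^ 2)))) :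
    μ.map D = (volume.restrict (Ioi 0)).withDensity fun r =>
      ENNReal.ofReal (2 * Real.pi * l * r * Real.exp (-(Real.pi * l * r ^ 2))) := by
  have := Measure.isProbabilityMeasure_map (μ := μ) hD.aemeasurable
  refine Measure.ext_of_Ici _ _ fun a => ?_
  rw [Measure.map_apply hD measurableSet_Ici, withDensity_apply _ measurableSet_Ici,
    Measure.restrict_restrict measurableSet_Ici]
  have hset : (Ici a ∩ Ioi 0 : Set ℝ) =ᵐ[volume] Ioi (max a 0) := by
    rw [← Ioi_inter_Ioi]
    exact Ioi_ae_eq_Ici.symm.inter (ae_eq_refl _)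
  rw [setLIntegral_congr hset, lintegral_Ioi_rayleigh hl (le_max_right _ _),
    ← htail _ (le_max_right _ _)]
  congr 1
  ext ω
  simp [hnn ω]

variable {ι : Type*} [Fintype ι]

/-- Independent distances `D s` with tails `exp (-π lₛ r²)` compete: conditionally on `D t = r`, the
others clear the thresholds `ρ s r` with probability `∏ exp (-π lₛ (ρ s r)²)`. Since `ρ t r = r`,
the density of `D t` supplies the factor missing for `s = t`. -/
lemma measure_competition {D : ι → Ω → ℝ} (hD : ∀ s, Measurable (D s)) (hindep : iIndepFun D μ)
    (hnn : ∀ s ω, 0 ≤ D s ω) {l : ι → ℝ} (hl : ∀ s, 0 < l s)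
    (htail : ∀ s r, 0 ≤ r →
      μ {ω | r ≤ D s ω} = ENNReal.ofReal (Real.exp (-(Real.pi * l s * r ^ 2))))
    {ρ : ι → ℝ → ℝ} (hρ : ∀ s, Measurable (ρ s)) (hρnn : ∀ s r, 0 < r → 0 ≤ ρ s r) {t : ι}
    (hρt : ∀ r, 0 < r → ρ t r = r) {B : Set ℝ} (hB : MeasurableSet B) :
    μ {ω | (∀ s, ρ s (D t ω) ≤ D s ω) ∧ D t ω ∈ B} =
      ∫⁻ r in B ∩ Ioi 0, ENNReal.ofReal
        (2 * Real.pi * l t * (r * Real.exp (-(Real.pi * ∑ s, l s * ρ s r ^ 2)))) := by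
  classical
  set T : Finset ι := Finset.univ.erase t with hT
  set X : Ω → T → ℝ := fun ω s => D s ω with hX
  have hXm : Measurable X := measurable_pi_lambda _ fun s => hD s
  have hind : IndepFun (D t) X μ :=
    (hindep.indepFun_finset {t} T (by simp [hT]) hD).comp
      (φ := fun x : ({t} : Finset ι) → ℝ => x ⟨t, by simp⟩) (measurable_pi_apply _) measurable_id
  have hlaw := map_eq_withDensity_of_tail (hD t) (hl t) (hnn t) (htail t)
  have hpos : ∀ᵐ ω ∂μ, 0 < D t ω := by
    refine ae_of_ae_map (hD t).aemeasurable ?_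
    rw [hlaw]
    exact (withDensity_absolutelyContinuous _ _).ae_le (ae_restrict_mem measurableSet_Ioi)
  set C : Set (ℝ × (T → ℝ)) := {p | (∀ s : T, ρ s p.1 ≤ p.2 s) ∧ p.1 ∈ B} with hC
  have hCm : MeasurableSet C := by
    have hCeq : C = (⋂ s : T, {p : ℝ × (T → ℝ) | ρ s p.1 ≤ p.2 s}) ∩ Prod.fst ⁻¹' B := by
      ext p
      simp [hC]
    rw [hCeq]
    exact (MeasurableSet.iInter fun s : T => measurableSet_le
      (f := fun p : ℝ × (T → ℝ) => ρ s p.1) (g := fun p => p.2 s) ((hρ s).comp measurable_fst)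
      ((measurable_pi_apply s).comp measurable_snd)).inter (measurable_fst hB)
  have hev : μ {ω | (∀ s, ρ s (D t ω) ≤ D s ω) ∧ D t ω ∈ B} =
      μ ((fun ω => (D t ω, X ω)) ⁻¹' C) := by
    refine measure_congr ?_
    filter_upwards [hpos] with ω hω
    refine propext (and_congr_left fun _ => ⟨fun h s => h s, fun h s => ?_⟩)
    by_cases hs : s = t
    · subst hs
      exact (hρt _ hω).le
    · exact h ⟨s, by simp [hT, hs]⟩
  have hslice (r : ℝ) (hr : 0 < r) : μ.map X (Prod.mk r ⁻¹' C) =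
      B.indicator (fun r => ∏ s ∈ T,
        ENNReal.ofReal (Real.exp (-(Real.pi * l s * ρ s r ^ 2)))) r := by
    by_cases hrB : r ∈ B
    · rw [indicator_of_mem hrB, Measure.map_apply hXm (measurable_prodMk_left hCm)]
      have h := hindep.measure_inter_preimage_eq_mul T (sets := fun s => Ici (ρ s r))
        fun s _ => measurableSet_Ici
      rw [← Finset.prod_congr rfl fun s _ => htail s _ (hρnn s r hr)]
      refine Eq.trans (congrArg μ ?_) h
      ext ω
      simp [hC, hX, hrB]
    · rw [indicator_of_notMem hrB]
      rw [show Prod.mk r ⁻¹' C = ∅ by ext x; simp [hC, hrB], measure_empty]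
  have hdens : Measurable fun r : ℝ =>
      ENNReal.ofReal (2 * Real.pi * l t * r * Real.exp (-(Real.pi * l t * r ^ 2))) := by
    fun_prop
  rw [hev, ← Measure.map_apply ((hD t).prodMk hXm) hCm,
    hind.map_prod_eq_prod_map_map (hD t).aemeasurable hXm.aemeasurable,
    Measure.prod_apply hCm, hlaw,
    lintegral_withDensity_eq_lintegral_mul _ hdens (measurable_measure_prodMk_left hCm),
    ← setLIntegral_indicator hB]
  refine setLIntegral_congr_fun measurableSet_Ioi fun r (hr : 0 < r) => ?_
  rw [Pi.mul_apply, hslice r hr]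
  by_cases hrB : r ∈ B
  · have hsum : Real.pi * ∑ s, l s * ρ s r ^ 2 =
        Real.pi * l t * r ^ 2 + ∑ s ∈ T, Real.pi * l s * ρ s r ^ 2 := by
      rw [← Finset.add_sum_erase _ _ (Finset.mem_univ t), hρt r hr, mul_add, Finset.mul_sum]
      simp only [hT, mul_assoc]
    have hlt := hl t
    rw [indicator_of_mem hrB, indicator_of_mem hrB,
      ← ENNReal.ofReal_prod_of_nonneg fun s _ => (Real.exp_pos _).le, ← Real.exp_sum,
      ← ENNReal.ofReal_mul (by positivity), hsum, neg_add, Real.exp_add, Finset.sum_neg_distrib]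
    congr 1
    ring
  · simp [indicator_of_notMem hrB]

end Competition

/-! ### Exclusion radii and the serving base station -/

namespace HetNet

variable {K : ℕ} {net : HetNet K}

lemma downlinkGain_eq (hN : 1 ≤ net.N) : net.downlinkGain = (net.N : ℝ) + net.S - 1 := by
  rw [downlinkGain, expMeasure, integral_id_gammaMeasure (by exact_mod_cast hN) one_pos,
    integral_id_gammaMeasure one_pos one_pos]
  ring

/-- The average power received from a base station of tier `t` at distance `r` is
`powerCoeff t * r ^ (-α t)`. -/
noncomputable def powerCoeff (net : HetNet K) : Tier K → ℝ
  | none => net.downlinkGain * (net.P Tier.mbs / net.S) * net.β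
  | some k => net.P (Tier.sbs k) * net.β

lemma receivedPower_eq (t : Tier K) (r : ℝ) :
    net.receivedPower t r = net.powerCoeff t * r ^ (-(net.α t)) := by
  cases t <;> simp only [receivedPower, powerCoeff, pathLoss, mul_assoc]

lemma powerCoeff_pos (hN : 1 ≤ net.N) (hS : 1 ≤ net.S) (hβ : 0 < net.β) (hP : ∀ t, 0 < net.P t)
    (t : Tier K) : 0 < net.powerCoeff t := by
  have hN' : (1 : ℝ) ≤ net.N := by exact_mod_cast hN
  have hS' : (1 : ℝ) ≤ net.S := by exact_mod_cast hS
  have hG : 0 < net.downlinkGain := by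
    rw [downlinkGain_eq hN]
    linarith
  cases t with
  | none => exact mul_pos (mul_pos hG (div_pos (hP _) (by linarith))) hβ
  | some k => exact mul_pos (hP _) hβ

/-- The distance at which a base station of tier `s` is received with the same average power as a
base station of tier `t` at distance `r`. -/
noncomputable def exclusionRadius (net : HetNet K) (t s : Tier K) (r : ℝ) : ℝ :=
  (net.powerCoeff t / net.powerCoeff s) ^ (-1 / net.α s) * r ^ (net.α t / net.α s)

lemma measurable_exclusionRadius (t s : Tier K) : Measurable (net.exclusionRadius t s) := by
  unfold exclusionRadius
  fun_prop

lemma exclusionRadius_pos (hA : ∀ t, 0 < net.powerCoeff t) (t s : Tier K) {r : ℝ} (hr : 0 < r) :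
    0 < net.exclusionRadius t s r :=
  mul_pos (Real.rpow_pos_of_pos (div_pos (hA t) (hA s)) _) (Real.rpow_pos_of_pos hr _)

lemma exclusionRadius_self (hA : ∀ t, 0 < net.powerCoeff t) (hα : ∀ t, 0 < net.α t) (t : Tier K)
    (r : ℝ) : net.exclusionRadius t t r = r := by
  rw [exclusionRadius, div_self (hA t).ne', div_self (hα t).ne', Real.one_rpow, Real.rpow_one,
    one_mul]

lemma receivedPower_le_iff (hA : ∀ t, 0 < net.powerCoeff t) (hα : ∀ t, 0 < net.α t)
    (t s : Tier K) {r d : ℝ} (hr : 0 < r) (hd : 0 < d) :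
    net.receivedPower s d ≤ net.receivedPower t r ↔ net.exclusionRadius t s r ≤ d := by
  have hαs := (hα s).ne'
  have hquot := div_pos (hA t) (hA s)
  have hpow : net.exclusionRadius t s r ^ (-(net.α s)) =
      net.powerCoeff t / net.powerCoeff s * r ^ (-(net.α t)) := by
    rw [exclusionRadius, Real.mul_rpow (Real.rpow_pos_of_pos hquot _).le
      (Real.rpow_pos_of_pos hr _).le, ← Real.rpow_mul hquot.le, ← Real.rpow_mul hr.le]
    congr 1
    · rw [show -1 / net.α s * -(net.α s) = 1 by field_simp, Real.rpow_one]
    · congr 1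
      field_simp
  rw [← Real.rpow_le_rpow_iff_of_neg hd (exclusionRadius_pos hA t s hr) (neg_neg_of_pos (hα s)),
    hpow, receivedPower_eq, receivedPower_eq, div_mul_eq_mul_div, le_div_iff₀ (hA s), mul_comm]

section Association

variable {Ω : Type*} {Φ : Tier K → Ω → Set Plane} {u : Plane} {ω : Ω}

/-- The serving base stations of tier `t` are the nearest ones of the tier, provided that no tier `s`
has a base station strictly within its exclusion radius. Positivity of `infDist` says that
each tier has a base station and that none of them is at `u`. -/
lemma isServing_iff (hA : ∀ t, 0 < net.powerCoeff t) (hα : ∀ t, 0 < net.α t)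
    (hpos : ∀ s, 0 < Metric.infDist u (Φ s ω)) {t : Tier K} {x : Plane} :
    net.IsServing Φ u ω t x ↔ x ∈ Φ t ω ∧ dist u x = Metric.infDist u (Φ t ω) ∧
      ∀ s, net.exclusionRadius t s (Metric.infDist u (Φ t ω)) ≤ Metric.infDist u (Φ s ω) := by
  have hne (s) : (Φ s ω).Nonempty := by
    by_contra h
    have := hpos s
    simp [not_nonempty_iff_eq_empty.1 h] at this
  have hdist {s} {y} (hy : y ∈ Φ s ω) : 0 < dist u y :=
    (hpos s).trans_le (Metric.infDist_le_dist_of_mem hy)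
  have hpow {x} (hx : x ∈ Φ t ω) :
      (∀ s, ∀ y ∈ Φ s ω, net.receivedPower s (dist u y) ≤ net.receivedPower t (dist u x)) ↔
        ∀ s, net.exclusionRadius t s (dist u x) ≤ Metric.infDist u (Φ s ω) :=
    forall_congr' fun s => by
      rw [Metric.le_infDist (hne s)]
      exact forall₂_congr fun y hy => receivedPower_le_iff hA hα t s (hdist hx) (hdist hy)
  refine and_congr_right fun hx => ?_
  rw [hpow hx]
  constructor
  · intro h
    have hx' : dist u x = Metric.infDist u (Φ t ω) := by
      refine le_antisymm ?_ (Metric.infDist_le_dist_of_mem hx)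
      simpa only [exclusionRadius_self hA hα] using h t
    exact ⟨hx', hx' ▸ h⟩
  · rintro ⟨h1, h2⟩
    rwa [h1]

lemma exists_dist_eq_infDist {s : Set Plane}
    (hs : ∀ B : Set Plane, Bornology.IsBounded B → (s ∩ B).Finite) (hne : s.Nonempty) (u : Plane) :
    ∃ x ∈ s, dist u x = Metric.infDist u s := by
  obtain ⟨y, hy⟩ := hne
  obtain ⟨x, ⟨hx, hxy⟩, hmin⟩ := Set.exists_min_image _ (dist u)
    (hs _ (Metric.isBounded_closedBall (x := u) (r := dist u y)))
    ⟨y, hy, by simp [dist_comm]⟩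
  refine ⟨x, hx, le_antisymm ((Metric.le_infDist ⟨y, hy⟩).2 fun z hz => ?_)
    (Metric.infDist_le_dist_of_mem hx)⟩
  by_cases hzy : dist u z ≤ dist u y
  · exact hmin z ⟨hz, by simpa [dist_comm] using hzy⟩
  · rw [Metric.mem_closedBall, dist_comm] at hxy
    exact hxy.trans (le_of_not_ge hzy)

lemma mem_assocEvent_iff (hA : ∀ t, 0 < net.powerCoeff t) (hα : ∀ t, 0 < net.α t)
    (hpos : ∀ s, 0 < Metric.infDist u (Φ s ω)) {t : Tier K}
    (hfin : ∀ B : Set Plane, Bornology.IsBounded B → (Φ t ω ∩ B).Finite) :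
    ω ∈ net.assocEvent Φ u t ↔
      ∀ s, net.exclusionRadius t s (Metric.infDist u (Φ t ω)) ≤ Metric.infDist u (Φ s ω) := by
  have hne : (Φ t ω).Nonempty := by
    by_contra h
    have := hpos t
    simp [not_nonempty_iff_eq_empty.1 h] at this
  obtain ⟨x, hx, hxd⟩ := exists_dist_eq_infDist hfin hne u
  simp only [assocEvent, mem_ofPred_eq, isServing_iff hA hα hpos]
  exact ⟨fun ⟨_, _, _, h⟩ => h, fun h => ⟨x, hx, hxd, h⟩⟩

lemma servingDist_eq (hA : ∀ t, 0 < net.powerCoeff t) (hα : ∀ t, 0 < net.α t)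
    (hpos : ∀ s, 0 < Metric.infDist u (Φ s ω)) {t : Tier K} (hω : ω ∈ net.assocEvent Φ u t) :
    net.servingDist Φ u t ω = Metric.infDist u (Φ t ω) := by
  obtain ⟨x, hx⟩ := hω
  rw [servingDist, ← csInf_singleton (Metric.infDist u (Φ t ω))]
  congr 1
  ext r
  simp only [mem_ofPred_eq, mem_singleton_iff]
  constructor
  · rintro ⟨y, hy, rfl⟩
    exact ((isServing_iff hA hα hpos).1 hy).2.1
  · rintro rfl
    exact ⟨x, hx, ((isServing_iff hA hα hpos).1 hx).2.1.symm⟩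

/-! ### The law of the serving distance -/

variable [MeasurableSpace Ω] {μ : Measure Ω} [IsProbabilityMeasure μ]

/-- The law of the association with tier `t` and of the serving distance. The function `κ` stands
for `kernelM` or `kernelS k`; only its values on `(0, ∞)` matter. -/
lemma assoc_law (hA : ∀ t, 0 < net.powerCoeff t) (hα : ∀ t, 0 < net.α t)
    (hdens : ∀ t, 0 < net.dens t) (hΦ : ∀ t, IsHPPP (Φ t) (net.dens t) μ)
    (hindep : iIndep (fun t => pointSigma (Φ t)) μ) (t : Tier K) {κ : ℝ → ℝ} (hκm : Measurable κ)
    (hκ : ∀ r, 0 < r → κ r =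
      r * Real.exp (-(Real.pi * ∑ s, net.dens s * net.exclusionRadius t s r ^ 2))) {ψ : ℝ}
    (hψ : ψ = 2 * Real.pi * net.dens t * ∫ r in Ioi 0, κ r) :
    NullMeasurableSet (net.assocEvent Φ u t) μ ∧ IntegrableOn κ (Ioi 0) ∧ 0 < ψ ∧
      μ (net.assocEvent Φ u t) = ENNReal.ofReal ψ ∧
      HasLaw (net.servingDist Φ u t)
        ((volume : Measure ℝ).withDensity fun x =>
          ENNReal.ofReal (if 0 ≤ x then 2 * Real.pi * net.dens t / ψ * κ x else 0))
        (ProbabilityTheory.cond μ (net.assocEvent Φ u t)) := by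
  set D : Tier K → Ω → ℝ := fun s ω => Metric.infDist u (Φ s ω) with hD
  have hDm (s) : Measurable (D s) := (hΦ s).measurable_infDist u
  have hDindep : iIndepFun D μ :=
    iIndep_of_iIndep_of_le hindep fun s => (measurable_infDist_pointSigma (Φ s) u).comap_le
  have htail (s r) (hr : 0 ≤ r) := (hΦ s).measure_le_infDist (hdens s) u hr
  have hpos : ∀ᵐ ω ∂μ, ∀ s, 0 < D s ω := by
    refine ae_all_iff.2 fun s => ae_of_ae_map (hDm s).aemeasurable ?_
    rw [map_eq_withDensity_of_tail (hDm s) (hdens s) (fun _ => Metric.infDist_nonneg) (htail s)]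
    exact (withDensity_absolutelyContinuous _ _).ae_le (ae_restrict_mem measurableSet_Ioi)
  set c : ℝ := 2 * Real.pi * net.dens t with hc
  have hcpos : 0 < c := mul_pos (by positivity) (hdens t)
  have hκpos {r : ℝ} (hr : 0 < r) : 0 < κ r := by
    rw [hκ r hr]
    positivity
  set E : Set Ω := {ω | ∀ s, net.exclusionRadius t s (D t ω) ≤ D s ω} with hE
  have hEm : MeasurableSet E := by
    have hEeq : E = ⋂ s, {ω | net.exclusionRadius t s (D t ω) ≤ D s ω} := by
      ext ω
      simp [hE]
    rw [hEeq]
    exact MeasurableSet.iInter fun s =>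
      measurableSet_le ((measurable_exclusionRadius t s).comp (hDm t)) (hDm s)
  have hassoc : net.assocEvent Φ u t =ᵐ[μ] E := by
    filter_upwards [hpos] with ω hω
    exact propext (mem_assocEvent_iff hA hα hω ((hΦ t).locallyFinite ω))
  have hmeas {B : Set ℝ} (hB : MeasurableSet B) :
      μ (E ∩ D t ⁻¹' B) = ∫⁻ r in B ∩ Ioi 0, ENNReal.ofReal (c * κ r) := by
    rw [← setLIntegral_congr_fun (hB.inter measurableSet_Ioi) fun r hr => by
      rw [hκ r hr.2]]
    exact measure_competition hDm hDindep (fun _ _ => Metric.infDist_nonneg) hdens htail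
      (fun s => measurable_exclusionRadius t s)
      (fun s r hr => (exclusionRadius_pos hA t s hr).le)
      (fun r _ => exclusionRadius_self hA hα t r) hB
  have hμE : μ E = ∫⁻ r in Ioi 0, ENNReal.ofReal (c * κ r) := by
    simpa using hmeas MeasurableSet.univ
  have hnn : 0 ≤ᵐ[volume.restrict (Ioi 0)] κ :=
    (ae_restrict_iff' measurableSet_Ioi).2 (ae_of_all _ fun r hr => (hκpos hr).le)
  have hcnn : 0 ≤ᵐ[volume.restrict (Ioi 0)] fun r => c * κ r := by
    filter_upwards [hnn] with r hr using mul_nonneg hcpos.le hr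
  -- The integral of `c * κ` is finite because it is a probability.
  have hcint : IntegrableOn (fun r => c * κ r) (Ioi 0) := by
    refine ⟨(hκm.const_mul c).aestronglyMeasurable, ?_⟩
    rw [hasFiniteIntegral_iff_ofReal hcnn, ← hμE]
    exact measure_lt_top μ E
  have hint : IntegrableOn κ (Ioi 0) := by
    refine (hcint.const_mul c⁻¹).congr (ae_of_all _ fun r => ?_)
    simp [hcpos.ne']
  have hψpos : 0 < ψ := by
    rw [hψ]
    refine mul_pos hcpos ?_
    rw [setIntegral_pos_iff_support_of_nonneg_ae hnn hint,
      inter_eq_right.2 fun r hr => Function.mem_support.2 (hκpos (mem_Ioi.1 hr)).ne']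
    simp
  have hμEψ : μ E = ENNReal.ofReal ψ := by
    rw [hμE, ← ofReal_integral_eq_lintegral_ofReal hcint hcnn, integral_const_mul, hψ]
  refine ⟨hEm.nullMeasurableSet.congr hassoc.symm, hint, hψpos, (measure_congr hassoc).trans hμEψ,
    ?_⟩
  have hcond : ProbabilityTheory.cond μ (net.assocEvent Φ u t) = ProbabilityTheory.cond μ E := by
    rw [ProbabilityTheory.cond, ProbabilityTheory.cond, measure_congr hassoc,
      Measure.restrict_congr_set hassoc]
  have hdist : net.servingDist Φ u t =ᵐ[ProbabilityTheory.cond μ E] D t := by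
    have hE' : ∀ᵐ ω ∂(ProbabilityTheory.cond μ E), ω ∈ E := ae_cond_mem hEm
    have hac : ProbabilityTheory.cond μ E ≪ μ := cond_absolutelyContinuous
    filter_upwards [hE', hac.ae_le hpos] with ω hω hω'
    exact servingDist_eq hA hα hω'
      ((mem_assocEvent_iff hA hα hω' ((hΦ t).locallyFinite ω)).2 hω)
  rw [hcond]
  refine HasLaw.congr ⟨(hDm t).aemeasurable, ?_⟩ hdist
  ext B hB
  have hpdf : ∀ x, ENNReal.ofReal (if 0 ≤ x then c / ψ * κ x else 0) =
      (Ici 0).indicator (fun x => (ENNReal.ofReal ψ)⁻¹ * ENNReal.ofReal (c * κ x)) x := fun x => by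
    by_cases hx : 0 ≤ x
    · rw [if_pos hx, indicator_of_mem (mem_Ici.2 hx), ← ENNReal.ofReal_inv_of_pos hψpos,
        ← ENNReal.ofReal_mul (inv_nonneg.2 hψpos.le)]
      congr 1
      ring
    · simp [hx]
  have hset : (Ici 0 ∩ B : Set ℝ) =ᵐ[volume] (B ∩ Ioi 0 : Set ℝ) := by
    rw [inter_comm]
    exact (ae_eq_refl B).inter Ioi_ae_eq_Ici.symm
  rw [Measure.map_apply (hDm t) hB, cond_apply hEm, hmeas hB, withDensity_apply _ hB, hμEψ]
  simp_rw [hpdf]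
  rw [setLIntegral_indicator measurableSet_Ici, setLIntegral_congr hset,
    lintegral_const_mul _ (hκm.const_mul c).ennreal_ofReal]

end Association

/-! ### The kernels in terms of exclusion radii -/

lemma measurable_kernelM : Measurable net.kernelM := by
  unfold kernelM
  fun_prop

lemma measurable_kernelS (k : SmallTier K) : Measurable (net.kernelS k) := by
  unfold kernelS
  fun_prop

lemma rpow_div_sq {r : ℝ} (hr : 0 < r) (a b : ℝ) : (r ^ (a / b)) ^ 2 = r ^ (2 * a / b) := by
  rw [← Real.rpow_mul_natCast hr.le]
  congr 1
  push_cast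
  ring

lemma kernelM_eq (hN : 1 ≤ net.N) (hβ : 0 < net.β) (hA : ∀ t, 0 < net.powerCoeff t)
    (hα : ∀ t, 0 < net.α t) {r : ℝ} (hr : 0 < r) :
    net.kernelM r = r * Real.exp (-(Real.pi *
      ∑ s, net.dens s * net.exclusionRadius Tier.mbs s r ^ 2)) := by
  have hi (i : SmallTier K) : net.exclusionRadius Tier.mbs (Tier.sbs i) r ^ 2 =
      net.rMS i ^ 2 * r ^ (2 * net.α Tier.mbs / net.α (Tier.sbs i)) := by
    rw [exclusionRadius, mul_pow, rpow_div_sq hr, rMS, ← downlinkGain_eq hN]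
    congr 4
    simp only [powerCoeff]
    rw [mul_div_mul_right _ _ hβ.ne', mul_div_assoc, div_div]
  rw [kernelM, Fintype.sum_option]
  simp only [exclusionRadius_self hA hα, hi, mul_assoc]
  congr 2
  ring

lemma kernelS_eq (hN : 1 ≤ net.N) (hβ : 0 < net.β) (k : SmallTier K) {r : ℝ} (hr : 0 < r) :
    net.kernelS k r = r * Real.exp (-(Real.pi *
      ∑ s, net.dens s * net.exclusionRadius (Tier.sbs k) s r ^ 2)) := by
  have hi (i : SmallTier K) : net.exclusionRadius (Tier.sbs k) (Tier.sbs i) r ^ 2 =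
      net.rSS k i ^ 2 * r ^ (2 * net.α (Tier.sbs k) / net.α (Tier.sbs i)) := by
    rw [exclusionRadius, mul_pow, rpow_div_sq hr, rSS]
    simp only [powerCoeff]
    rw [mul_div_mul_right _ _ hβ.ne']
  have hM : net.exclusionRadius (Tier.sbs k) Tier.mbs r ^ 2 =
      net.rSM k ^ 2 * r ^ (2 * net.α (Tier.sbs k) / net.α Tier.mbs) := by
    rw [exclusionRadius, mul_pow, rpow_div_sq hr, rSM, ← downlinkGain_eq hN]
    congr 3
    simp only [powerCoeff]
    rw [mul_div_mul_right _ _ hβ.ne', ← mul_div_assoc, div_div_eq_mul_div, mul_comm (net.S : ℝ)]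
  rw [kernelS, Fintype.sum_option]
  simp only [hM, hi, mul_assoc]
  congr 2
  ring

end HetNet

theorem lemma1 {K : ℕ} (net : HetNet K)
    (hN : 1 ≤ net.N) (hS : 1 ≤ net.S) (hβ : 0 < net.β)
    (hP : ∀ t, 0 < net.P t) (hα : ∀ t, 0 < net.α t) (hdens : ∀ t, 0 < net.dens t)
    {Ω : Type*} [MeasurableSpace Ω] (μ : Measure Ω) [IsProbabilityMeasure μ]
    (Φ : Tier K → Ω → Set Plane)
    (hΦ : ∀ t, IsHPPP (Φ t) (net.dens t) μ)
    (hindep : iIndep (fun t => pointSigma (Φ t)) μ)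
    (u : Plane) :
    -- the downlink power gain
    net.downlinkGain = (net.N : ℝ) + net.S - 1 ∧
    -- the typical user is associated with an MBS with probability `Ψ_M`
    NullMeasurableSet (net.assocEvent Φ u Tier.mbs) μ ∧
    IntegrableOn net.kernelM (Set.Ioi 0) ∧
    0 < net.psiM ∧
    μ (net.assocEvent Φ u Tier.mbs) = ENNReal.ofReal net.psiM ∧
    -- the distance to the serving MBS has density `pdfM`
    HasLaw (net.servingDist Φ u Tier.mbs)
      ((volume : Measure ℝ).withDensity fun x => ENNReal.ofReal (net.pdfM x))
      (ProbabilityTheory.cond μ (net.assocEvent Φ u Tier.mbs)) ∧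
    -- the same for each small-cell tier, with `Ψ_k` and `pdfS`
    ∀ k : SmallTier K,
      NullMeasurableSet (net.assocEvent Φ u (Tier.sbs k)) μ ∧
      IntegrableOn (net.kernelS k) (Set.Ioi 0) ∧
      0 < net.psiS k ∧
      μ (net.assocEvent Φ u (Tier.sbs k)) = ENNReal.ofReal (net.psiS k) ∧
      HasLaw (net.servingDist Φ u (Tier.sbs k))
        ((volume : Measure ℝ).withDensity fun y => ENNReal.ofReal (net.pdfS k y))
        (ProbabilityTheory.cond μ (net.assocEvent Φ u (Tier.sbs k))) := by

  have hA := HetNet.powerCoeff_pos hN hS hβ hP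
  refine ⟨HetNet.downlinkGain_eq hN, ?_⟩
  obtain ⟨h1, h2, h3, h4, h5⟩ := HetNet.assoc_law (u := u) hA hα hdens hΦ hindep Tier.mbs
    HetNet.measurable_kernelM (fun r hr => HetNet.kernelM_eq hN hβ hA hα hr) rfl
  exact ⟨h1, h2, h3, h4, h5, fun k => HetNet.assoc_law hA hα hdens hΦ hindep (Tier.sbs k)
    (HetNet.measurable_kernelS k) (fun r hr => HetNet.kernelS_eq hN hβ k hr) rfl⟩
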